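/- Let $d\ge 2$. Let $\mathcal F$ denote the Fourier transform on the tempered distributions $\mathcal S'(\mathbb R^d)$ (with kernel $(2\pi)^{-d/2}e^{-ix\cdot\xi}$). Let $\phi_0\in\mathcal S(\mathbb R^d)$ be non-negative with $\phi_0(x)=1$ for $|x|\le 1$ and $\phi_0(x)=0$ for $|x|\ge \frac32$, and put $\phi_j(x)=\phi_0(2^{-j}x)-\phi_0(2^{-j+1}x)$ for $j\ge 1$. Let $\varphi_0\in C_0^\infty(\mathbb R)$ with $\varphi_0=1$ on $[-1,1]$ and $\operatorname{supp}\varphi_0\subset[-\frac32,\frac32]$, put $\varphi_j(\xi)=\varphi_0(2^{-j}\xi)-\varphi_0(2^{-j+1}\xi)$ for $j\ge1$, and $\varphi_{\bar k}(x)=\varphi_{k_1}(x_1)\cdots\varphi_{k_d}(x_d)$ for $\bar k\in\mathbb N_0^d$. For $0<p<\infty$, $0<q\le\infty$, $t\in\mathbb R$, the isotropic Lizorkin–Triebel space $F^t_{p,q}(\mathbb R^d)$ and the Lizorkin–Triebel space of dominating mixed smoothness $S^t_{p,q}F(\mathbb R^d)$ consist of all $f\in\mathcal S'(\mathbb R^d)$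 for which, respectively, $$\|f|F^t_{p,q}\|=\Big\|\Big(\sum_{j=0}^\infty 2^{jtq}\,|\mathcal F^{-1}[\phi_j\mathcal F f]|^q\Big)^{1/q}\Big|L_p(\mathbb R^d)\Big\|,\qquad \|f|S^t_{p,q}F\|=\Big\|\Big(\sum_{\bar k\in\mathbb N_0^d}2^{(k_1+\dots+k_d)tq}\,|\mathcal F^{-1}[\varphi_{\bar k}\mathcal F f]|^q\Big)^{1/q}\Big|L_p(\mathbb R^d)\Big\|$$ is finite (with a supremum in place of the sum if $q=\infty$). Write $X\hookrightarrow Y$ if $X\subset Y$ and the inclusion is continuous, i.e. $\|f|Y\|\le C\,\|f|X\|$ for all $f\in X$ with a constant $C$ independent of $f$. Let $0<p_0,p<\infty$, $0<q_0,q\le\infty$ and $t_0,t\in\mathbb R$. If $$F^{t_0}_{p_0,q_0}(\mathbb R^d)\hookrightarrow S^t_{p,q}F(\mathbb R^d),$$ then $$F^{t_0}_{p_0,q_0}(\mathbb R^d)\hookrightarrow F^{td}_{p,q}(\mathbb R^d).$$ In this sense, for fixed $p,q,t$, the space $F^{td}_{p,q}(\mathbb R^d)$ is the largest among all isotropic spaces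 $F^{t_0}_{p_0,q_0}(\mathbb R^d)$ that embed into $S^t_{p,q}F(\mathbb R^d)$. -/

import Mathlib

open scoped SchwartzMap FourierTransform ENNReal NNReal ContDiff

noncomputable section

namespace LizorkinTriebel

/-- The Euclidean space `ℝ^d`. -/
abbrev E (d : ℕ) : Type := EuclideanSpace ℝ (Fin d)

/-- A generator `φ₀` of an isotropic smooth dyadic decomposition of unity on `ℝ^d`: a smooth
non-negative function with `φ₀ x = 1` for `|x| ≤ 1` and `φ₀ x = 0` for `|x| ≥ 3/2`. -/
structure IsotropicGenerator (d : ℕ) where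
  toFun : E d → ℝ
  smooth : ContDiff ℝ ∞ toFun
  nonneg : ∀ x, 0 ≤ toFun x
  eq_one : ∀ x, ‖x‖ ≤ 1 → toFun x = 1
  eq_zero : ∀ x, 3 / 2 ≤ ‖x‖ → toFun x = 0

/-- A generator `χ₀ ∈ C₀^∞(ℝ)` of a smooth dyadic decomposition of unity on `ℝ`, whose `d`-fold
tensor product is used for the spaces of dominating mixed smoothness: `χ₀ = 1` on `[-1, 1]` and
`supp χ₀ ⊆ [-3/2, 3/2]`. -/
structure UnivariateGenerator where
  toFun : ℝ → ℂ
  smooth : ContDiff ℝ ∞ toFun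
  eq_one : ∀ x, |x| ≤ 1 → toFun x = 1
  tsupport_subset : tsupport toFun ⊆ Set.Icc (-(3 / 2)) (3 / 2)

/-- The dyadic system generated by `φ`: `φ_0 = φ` and `φ_j(x) = φ(2^{-j} x) - φ(2^{-j+1} x)` for
`j ≥ 1`. -/
def dyadic {V : Type*} [AddCommGroup V] [Module ℝ V] (φ : V → ℂ) : ℕ → V → ℂ
  | 0 => φ
  | j + 1 => fun x => φ (((2 : ℝ) ^ (j + 1))⁻¹ • x) - φ (((2 : ℝ) ^ j)⁻¹ • x)

theorem contDiff_dyadic {V : Type*} [NormedAddCommGroup V] [NormedSpace ℝ V] {φ : V → ℂ}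
    (hφ : ContDiff ℝ ∞ φ) (j : ℕ) : ContDiff ℝ ∞ (dyadic φ j) := by
  cases j with
  | zero => exact hφ
  | succ j =>
    exact (hφ.comp (contDiff_const_smul _)).sub (hφ.comp (contDiff_const_smul _))

theorem hasCompactSupport_dyadic {V : Type*} [NormedAddCommGroup V] [NormedSpace ℝ V]
    {φ : V → ℂ} (hφ : HasCompactSupport φ) (j : ℕ) : HasCompactSupport (dyadic φ j) := by
  cases j with
  | zero => exact hφ
  | succ j =>
    exact (hφ.comp_smul (by positivity)).sub (hφ.comp_smul (by positivity))

theorem IsotropicGenerator.contDiff_ofReal {d : ℕ} (φ : IsotropicGenerator d) :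
    ContDiff ℝ ∞ (fun x => (φ.toFun x : ℂ)) :=
  Complex.ofRealCLM.contDiff.comp φ.smooth

theorem IsotropicGenerator.hasCompactSupport {d : ℕ} (φ : IsotropicGenerator d) :
    HasCompactSupport (fun x => (φ.toFun x : ℂ)) := by
  refine HasCompactSupport.intro (isCompact_closedBall (0 : E d) (3 / 2)) fun x hx => ?_
  rw [mem_closedBall_zero_iff, not_le] at hx
  simp [φ.eq_zero x hx.le]

theorem UnivariateGenerator.hasCompactSupport (χ : UnivariateGenerator) :
    HasCompactSupport χ.toFun :=
  isCompact_Icc.of_isClosed_subset (isClosed_tsupport _) χ.tsupport_subset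

/-- The tensor product system `χ_k(x) = χ_{k_1}(x_1) ⋯ χ_{k_d}(x_d)`, `k ∈ ℕ₀^d`. -/
def tensor {d : ℕ} (χ : ℝ → ℂ) (k : Fin d → ℕ) : E d → ℂ :=
  fun x => ∏ i, dyadic χ (k i) (x i)

theorem contDiff_tensor {d : ℕ} {χ : ℝ → ℂ} (hχ : ContDiff ℝ ∞ χ) (k : Fin d → ℕ) :
    ContDiff ℝ ∞ (tensor χ k : E d → ℂ) :=
  contDiff_prod fun i _ =>
    (contDiff_dyadic hχ (k i)).comp (EuclideanSpace.proj (𝕜 := ℝ) i).contDiff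

theorem hasCompactSupport_tensor {d : ℕ} {χ : ℝ → ℂ} (hχ : HasCompactSupport χ)
    (k : Fin d → ℕ) : HasCompactSupport (tensor χ k : E d → ℂ) := by
  have hK : IsCompact (Set.univ.pi fun i => tsupport (dyadic χ (k i))) :=
    isCompact_univ_pi fun i => hasCompactSupport_dyadic hχ (k i)
  refine HasCompactSupport.intro
    ((EuclideanSpace.equiv (Fin d) ℝ).symm.toHomeomorph.isCompact_image.mpr hK) fun x hx => ?_
  by_contra h
  refine hx ⟨EuclideanSpace.equiv (Fin d) ℝ x, fun i _ => subset_tsupport _ ?_, by simp⟩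
  exact fun h0 => h (Finset.prod_eq_zero (Finset.mem_univ i) h0)

/-- The function `F⁻¹[m F f]` on `ℝ^d` for a tempered distribution `f` and a smooth compactly
supported `m`, where `F` is the Fourier transform with kernel `(2π)^{-d/2} e^{-i x·ξ}`.
In terms of the transform `𝓕` with kernel `e^{-2π i x·ξ}` one has
`F⁻¹[m F f] = 𝓕⁻¹[m(2π ·) 𝓕 f] = f * 𝓕⁻¹[m(2π ·)]`, which is the smooth function
`x ↦ f (𝓕⁻¹[m(2π ·)](x - ·)) = f (𝓕[m(2π ·)](· - x))`. -/
def piece {d : ℕ} (m : E d → ℂ) (hm : ContDiff ℝ ∞ m) (hs : HasCompactSupport m)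
    (f : 𝓢'(E d, ℂ)) (x : E d) : ℂ :=
  f (SchwartzMap.compSubConstCLM ℂ x (𝓕 (HasCompactSupport.toSchwartzMap
    (hs.comp_smul (c := 2 * Real.pi) (by positivity))
    (hm.comp (contDiff_const_smul (2 * Real.pi))))))

/-- The `ℓ_q` quasi-norm of a family of extended non-negative numbers, `0 < q ≤ ∞`. -/
def lqNorm {ι : Type*} (q : ℝ≥0∞) (a : ι → ℝ≥0∞) : ℝ≥0∞ :=
  if q = ⊤ then ⨆ i, a i else (∑' i, a i ^ q.toReal) ^ (1 / q.toReal)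

/-- The quasi-norm of `L_p(ℓ_q)` on `ℝ^d`, `0 < p < ∞`, `0 < q ≤ ∞`. -/
def lpLqNorm {d : ℕ} {ι : Type*} (p : ℝ) (q : ℝ≥0∞) (g : ι → E d → ℝ≥0∞) : ℝ≥0∞ :=
  (∫⁻ x, lqNorm q (fun i => g i x) ^ p) ^ (1 / p)

/-- The quasi-norm of the isotropic space `F^t_{p,q}(ℝ^d)` with respect to the generator `φ`
(`∞` if `f` is not in the space):
`‖ (∑_j 2^{jtq} |F⁻¹[φ_j F f]|^q)^{1/q} | L_p ‖`. -/
def normF {d : ℕ} (φ : IsotropicGenerator d) (t p : ℝ) (q : ℝ≥0∞) (f : 𝓢'(E d, ℂ)) : ℝ≥0∞ :=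
  lpLqNorm p q fun (j : ℕ) x =>
    ENNReal.ofReal ((2 : ℝ) ^ ((j : ℝ) * t)) *
      ‖piece (dyadic (fun x => (φ.toFun x : ℂ)) j) (contDiff_dyadic φ.contDiff_ofReal j)
        (hasCompactSupport_dyadic φ.hasCompactSupport j) f x‖ₑ

/-- The quasi-norm of the space of dominating mixed smoothness `S^t_{p,q}F(ℝ^d)` with respect to
the generator `χ` (`∞` if `f` is not in the space):
`‖ (∑_k 2^{|k|_1 tq} |F⁻¹[χ_k F f]|^q)^{1/q} | L_p ‖`, `k ∈ ℕ₀^d`. -/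
def normSF {d : ℕ} (χ : UnivariateGenerator) (t p : ℝ) (q : ℝ≥0∞) (f : 𝓢'(E d, ℂ)) : ℝ≥0∞ :=
  lpLqNorm p q fun (k : Fin d → ℕ) x =>
    ENNReal.ofReal ((2 : ℝ) ^ (((∑ i, k i : ℕ) : ℝ) * t)) *
      ‖piece (tensor χ.toFun k) (contDiff_tensor χ.smooth k)
        (hasCompactSupport_tensor χ.hasCompactSupport k) f x‖ₑ

/-- Continuous embedding `X ↪ Y` of the quasi-normed spaces of tempered distributions
`X = {f | N f < ∞}` and `Y = {f | M f < ∞}`: the set `X` is contained in `Y` and the (linear)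
inclusion map is bounded. -/
def Embeds {d : ℕ} (N M : 𝓢'(E d, ℂ) → ℝ≥0∞) : Prop :=
  (∀ f, N f < ⊤ → M f < ⊤) ∧ ∃ C : ℝ≥0, ∀ f, N f < ⊤ → M f ≤ C * N f

end LizorkinTriebel

end

noncomputable section

namespace LizorkinTriebel

/-! ### Continuity of translation on the Schwartz space. -/

section Translation

variable {V F : Type*} [NormedAddCommGroup V] [NormedSpace ℝ V] [NormedAddCommGroup F]
  [NormedSpace ℝ F]

/-! The isotropic piece `f_j` has its spectrum in the ball of radius `3/2 * 2^j`. Multiplying by a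
character translates the spectrum and leaves `|f_j|` unchanged. The translation by `frequency i₀ j`
carries that ball into a set where the isotropic multiplier of index `j + d + 7` and the tensor
multiplier with exponents `j + sideExponent i₀ i` equal `1`, and all other multipliers vanish
(`dyadic_add_frequency`, `tensor_add_frequency`).

Hence for the sum of the first `N` shifted pieces both quasi-norms are exact multiples of truncated
isotropic ones: of smoothness `t₀` on the left (`normF_shiftedSum`), and of smoothness `t * d` on
the right, since all `d` exponents grow with `j` (`normSF_shiftedSum`). Applying the assumed
embedding to this sum bounds every truncation, with constants independent of `N`; monotone
convergence finishes. The identities being exact, no multiplier theorem is needed and all `p`, `q`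
are treated alike. -/

theorem pow_mul_norm_iteratedFDeriv_sub_le (ψ : 𝓢(V, F)) (k n : ℕ) (x₀ : V) :
    ∃ C : ℝ, 0 ≤ C ∧ ∀ x, ‖x - x₀‖ ≤ 1 → ∀ y, ‖y‖ ^ k *
      ‖iteratedFDeriv ℝ n ψ (y - x) - iteratedFDeriv ℝ n ψ (y - x₀)‖ ≤ C * ‖x - x₀‖ := by
  set S : ℝ := 2 ^ k * (Finset.Iic (k, n + 1)).sup (fun m => SchwartzMap.seminorm ℝ m.1 m.2) ψ
  have hS : ∀ z, (1 + ‖z‖) ^ k * ‖iteratedFDeriv ℝ (n + 1) ψ z‖ ≤ S := fun z =>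
    SchwartzMap.one_add_le_sup_seminorm_apply (𝕜 := ℝ) (m := (k, n + 1)) le_rfl le_rfl ψ z
  have hS0 : 0 ≤ S := by positivity
  refine ⟨(2 + ‖x₀‖) ^ k * S, by positivity, fun x hx y => ?_⟩
  -- Mean value inequality: the segment stays within distance `1` of `y - x₀`, so `1 + ‖z‖` controls
  -- `1 + ‖y‖` up to the factor `2 + ‖x₀‖`.
  have hseg : ∀ z ∈ segment ℝ (y - x₀) (y - x),
      ‖fderiv ℝ (iteratedFDeriv ℝ n ψ) z‖ ≤ (2 + ‖x₀‖) ^ k * S / (1 + ‖y‖) ^ k := by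
    intro z hz
    rw [norm_fderiv_iteratedFDeriv, le_div_iff₀ (by positivity)]
    have hz1 : ‖z - (y - x₀)‖ ≤ 1 := by
      have := (convex_closedBall (y - x₀) (1 : ℝ)).segment_subset
        (Metric.mem_closedBall_self zero_le_one)
        (by rw [Metric.mem_closedBall, dist_eq_norm, sub_sub_sub_cancel_left, norm_sub_rev]
            exact hx) hz
      rwa [Metric.mem_closedBall, dist_eq_norm] at this
    have hy : 1 + ‖y‖ ≤ (2 + ‖x₀‖) * (1 + ‖z‖) := by
      have : ‖y‖ ≤ ‖z‖ + ‖x₀‖ + ‖z - (y - x₀)‖ := by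
        calc ‖y‖ = ‖z + x₀ - (z - (y - x₀))‖ := by congr 1; abel
          _ ≤ _ := (norm_sub_le _ _).trans (by gcongr; exact norm_add_le _ _)
      nlinarith [norm_nonneg z, norm_nonneg x₀, mul_nonneg (norm_nonneg z) (norm_nonneg x₀)]
    calc ‖iteratedFDeriv ℝ (n + 1) ψ z‖ * (1 + ‖y‖) ^ k
        ≤ ‖iteratedFDeriv ℝ (n + 1) ψ z‖ * ((2 + ‖x₀‖) * (1 + ‖z‖)) ^ k := by gcongr
      _ = (2 + ‖x₀‖) ^ k * ((1 + ‖z‖) ^ k * ‖iteratedFDeriv ℝ (n + 1) ψ z‖) := by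
        rw [mul_pow]; ring
      _ ≤ _ := by gcongr; exact hS z
  have hdiff : Differentiable ℝ (iteratedFDeriv ℝ n ψ) :=
    (ψ.smooth ⊤).differentiable_iteratedFDeriv (by exact_mod_cast WithTop.coe_lt_top _)
  have := Convex.norm_image_sub_le_of_norm_fderiv_le (fun z _ => hdiff z) hseg
    (convex_segment _ _) (left_mem_segment ℝ _ _) (right_mem_segment ℝ _ _)
  rw [sub_sub_sub_cancel_left, norm_sub_rev x₀ x] at this
  calc ‖y‖ ^ k * ‖iteratedFDeriv ℝ n ψ (y - x) - iteratedFDeriv ℝ n ψ (y - x₀)‖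
      ≤ (1 + ‖y‖) ^ k * ((2 + ‖x₀‖) ^ k * S / (1 + ‖y‖) ^ k * ‖x - x₀‖) := by
        gcongr; linarith
    _ = _ := by field_simp

/-- Translation is strongly continuous on the Schwartz space. -/
theorem continuous_compSubConstCLM [NormedSpace ℂ F] (ψ : 𝓢(V, F)) :
    Continuous fun x : V => SchwartzMap.compSubConstCLM ℂ x ψ := by
  rw [continuous_iff_continuousAt]
  intro x₀
  refine ((schwartz_withSeminorms ℂ V F).tendsto_nhds _ _).2 fun m ε hε => ?_
  obtain ⟨C, hC, h⟩ := pow_mul_norm_iteratedFDeriv_sub_le ψ m.1 m.2 x₀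
  have hδ : 0 < min 1 (ε / (C + 1)) := by positivity
  filter_upwards [Metric.ball_mem_nhds x₀ hδ] with x hx
  rw [Metric.mem_ball, dist_eq_norm, lt_min_iff] at hx
  refine lt_of_le_of_lt (SchwartzMap.seminorm_le_bound ℂ m.1 m.2 _
    (M := C * ‖x - x₀‖) (by positivity) fun y => ?_) ?_
  · have hcoe : ((SchwartzMap.compSubConstCLM ℂ x ψ - SchwartzMap.compSubConstCLM ℂ x₀ ψ :
        𝓢(V, F)) : V → F) = (fun y => ψ (y - x)) - fun y => ψ (y - x₀) := rfl
    have hsm : ∀ a : V, ContDiffAt ℝ m.2 (fun y => ψ (y - a)) y := fun a =>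
      ((ψ.smooth _).comp (contDiff_id.sub contDiff_const)).contDiffAt
    rw [hcoe, iteratedFDeriv_sub_apply (hsm _) (hsm _), iteratedFDeriv_comp_sub,
      iteratedFDeriv_comp_sub]
    exact h x hx.1.le y
  · have h2 := (lt_div_iff₀ (by positivity)).1 hx.2
    nlinarith [norm_nonneg (x - x₀)]

end Translation

/-! ### Multipliers acting on modulated distributions. -/

section Modulation

variable {V : Type*} [NormedAddCommGroup V] [InnerProductSpace ℝ V] [FiniteDimensional ℝ V]
  [MeasurableSpace V] [BorelSpace V]

theorem fourierInv_compSubConstCLM (ψ : 𝓢(V, ℂ)) (x η : V) :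
    (𝓕⁻ (SchwartzMap.compSubConstCLM ℂ x ψ) : 𝓢(V, ℂ)) η =
      (Real.fourierChar (inner ℝ x η) : ℂ) * (𝓕⁻ ψ : 𝓢(V, ℂ)) η := by
  rw [SchwartzMap.fourierInv_coe, SchwartzMap.fourierInv_coe, Real.fourierInv_eq,
    Real.fourierInv_eq, ← MeasureTheory.integral_add_right_eq_self _ x,
    ← MeasureTheory.integral_const_mul]
  congr 1 with y
  simp [inner_add_left, AddChar.map_add_eq_mul, Circle.smul_def]
  ring

/-- The tempered distribution obtained from `f` by applying the Fourier multiplier `a` and then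
modulating with frequency `v`. -/
def modulate (a : 𝓢(V, ℂ)) (v : V) (f : 𝓢'(V, ℂ)) : 𝓢'(V, ℂ) :=
  PointwiseConvergenceCLM.precomp ℂ
    ((FourierTransform.fourierCLM ℂ 𝓢(V, ℂ)) ∘L (SchwartzMap.smulLeftCLM ℂ a) ∘L
      (SchwartzMap.compSubConstCLM ℂ (-v)) ∘L (FourierTransform.fourierInvCLM ℂ 𝓢(V, ℂ))) f

theorem modulate_apply (a : 𝓢(V, ℂ)) (v : V) (f : 𝓢'(V, ℂ)) (ψ : 𝓢(V, ℂ)) :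
    modulate a v f ψ = f (𝓕 (SchwartzMap.smulLeftCLM ℂ a
      (SchwartzMap.compSubConstCLM ℂ (-v) (𝓕⁻ ψ)))) := rfl

/-- A multiplier that is constant on the shifted support of `a` acts on `modulate a v f` as a
scalar. -/
theorem modulate_apply_compSubConstCLM_fourier (a m : 𝓢(V, ℂ)) (v : V) (f : 𝓢'(V, ℂ)) (c : ℂ)
    (h : ∀ η, a η * m (η + v) = c * a η) (x : V) :
    modulate a v f (SchwartzMap.compSubConstCLM ℂ x (𝓕 m)) =
      c * (Real.fourierChar (inner ℝ x v) : ℂ) * f (SchwartzMap.compSubConstCLM ℂ x (𝓕 a)) := by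
  have key : SchwartzMap.smulLeftCLM ℂ a (SchwartzMap.compSubConstCLM ℂ (-v)
      (𝓕⁻ (SchwartzMap.compSubConstCLM ℂ x (𝓕 m)))) =
      (c * (Real.fourierChar (inner ℝ x v) : ℂ)) •
        (𝓕⁻ (SchwartzMap.compSubConstCLM ℂ x (𝓕 a)) : 𝓢(V, ℂ)) := by
    ext η
    rw [SchwartzMap.smulLeftCLM_apply_apply a.hasTemperateGrowth, smul_apply,
      SchwartzMap.compSubConstCLM_apply, fourierInv_compSubConstCLM, fourierInv_compSubConstCLM,
      FourierTransform.fourierInv_fourier_eq, FourierTransform.fourierInv_fourier_eq]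
    simp only [sub_neg_eq_add, inner_add_right, AddChar.map_add_eq_mul, smul_eq_mul,
      Circle.coe_mul]
    linear_combination (Real.fourierChar (inner ℝ x η) : ℂ) *
      (Real.fourierChar (inner ℝ x v) : ℂ) * h η
  rw [modulate_apply, key, FourierTransform.fourier_smul, FourierTransform.fourier_fourierInv_eq,
    map_smul, smul_eq_mul]

end Modulation

/-! ### The quasi-norms of `ℓ_q` and `L_p(ℓ_q)`. -/

section SequenceNorms

variable {ι κ : Type*} {q : ℝ≥0∞}

theorem lqNorm_mono {a b : ι → ℝ≥0∞} (h : ∀ i, a i ≤ b i) : lqNorm q a ≤ lqNorm q b := by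
  unfold lqNorm
  split_ifs
  · exact iSup_mono h
  · exact ENNReal.rpow_le_rpow
      (ENNReal.tsum_le_tsum fun i => ENNReal.rpow_le_rpow (h i) ENNReal.toReal_nonneg)
      (by positivity)

theorem lqNorm_const_mul (hq : 0 < q) (c : ℝ≥0∞) (a : ι → ℝ≥0∞) :
    lqNorm q (fun i => c * a i) = c * lqNorm q a := by
  unfold lqNorm
  split_ifs with hqt
  · rw [ENNReal.mul_iSup]
  · have hq' : 0 < q.toReal := ENNReal.toReal_pos hq.ne' hqt
    simp_rw [ENNReal.mul_rpow_of_nonneg _ _ hq'.le]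
    rw [ENNReal.tsum_mul_left, ENNReal.mul_rpow_of_nonneg _ _ (by positivity),
      ← ENNReal.rpow_mul, mul_one_div_cancel hq'.ne', ENNReal.rpow_one]

theorem lqNorm_comp_of_injective (hq : 0 < q) {e : κ → ι} (he : Function.Injective e)
    {a : ι → ℝ≥0∞} (ha : ∀ i, i ∉ Set.range e → a i = 0) :
    lqNorm q a = lqNorm q (fun j => a (e j)) := by
  unfold lqNorm
  split_ifs with hqt
  · refine le_antisymm (iSup_le fun i => ?_) (iSup_le fun j => le_iSup a (e j))
    by_cases hi : i ∈ Set.range e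
    · obtain ⟨j, rfl⟩ := hi
      exact le_iSup (fun j => a (e j)) j
    · simp [ha i hi]
  · have hq' : 0 < q.toReal := ENNReal.toReal_pos hq.ne' hqt
    congr 1
    refine (he.tsum_eq (f := fun i => a i ^ q.toReal) fun i hi => ?_).symm
    by_contra hi'
    exact hi (by simp [ha i hi', hq'])

theorem lqNorm_eq_iSup_truncation (hq : 0 < q) (a : ℕ → ℝ≥0∞) :
    lqNorm q a = ⨆ N : ℕ, lqNorm q (fun j => if j < N then a j else 0) := by
  unfold lqNorm
  split_ifs with hqt
  · rw [iSup_comm]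
    refine iSup_congr fun j => le_antisymm ?_ (iSup_le fun N => by split_ifs <;> simp)
    exact le_iSup_of_le (j + 1) (by simp)
  · have hq' : 0 < q.toReal := ENNReal.toReal_pos hq.ne' hqt
    have hq'' : 0 < 1 / q.toReal := by positivity
    have hsum : ∀ N : ℕ, ∑' j, (if j < N then a j else 0) ^ q.toReal =
        ∑ j ∈ Finset.range N, a j ^ q.toReal := fun N => by
      rw [tsum_eq_sum (s := Finset.range N) fun j hj => by
        rw [Finset.mem_range] at hj; simp [hj, hq']]
      exact Finset.sum_congr rfl fun j hj => by simp [Finset.mem_range.1 hj]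
    simp_rw [hsum]
    rw [ENNReal.tsum_eq_iSup_nat]
    exact (ENNReal.orderIsoRpow _ hq'').map_iSup _

theorem measurable_lqNorm {α : Type*} [MeasurableSpace α] [Countable ι] {g : ι → α → ℝ≥0∞}
    (hg : ∀ i, Measurable (g i)) : Measurable fun x => lqNorm q fun i => g i x := by
  unfold lqNorm
  split_ifs
  · exact Measurable.iSup hg
  · exact (Measurable.tsum fun i => (hg i).pow_const _).pow_const _

variable {d : ℕ} {p : ℝ}

theorem lpLqNorm_mono (hp : 0 < p) {g h : ι → E d → ℝ≥0∞} (hgh : ∀ i x, g i x ≤ h i x) :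
    lpLqNorm p q g ≤ lpLqNorm p q h :=
  ENNReal.rpow_le_rpow (MeasureTheory.lintegral_mono fun x =>
    ENNReal.rpow_le_rpow (lqNorm_mono fun i => hgh i x) hp.le) (by positivity)

theorem lpLqNorm_const_mul (hp : 0 < p) (hq : 0 < q) {c : ℝ≥0∞} (hc : c ≠ ⊤)
    (g : ι → E d → ℝ≥0∞) : lpLqNorm p q (fun i x => c * g i x) = c * lpLqNorm p q g := by
  unfold lpLqNorm
  simp_rw [lqNorm_const_mul hq, ENNReal.mul_rpow_of_nonneg _ _ hp.le]
  rw [MeasureTheory.lintegral_const_mul' _ _ (ENNReal.rpow_ne_top_of_nonneg hp.le hc),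
    ENNReal.mul_rpow_of_nonneg _ _ (by positivity), ← ENNReal.rpow_mul,
    mul_one_div_cancel hp.ne', ENNReal.rpow_one]

theorem lpLqNorm_comp_of_injective (hq : 0 < q) {e : κ → ι} (he : Function.Injective e)
    {g : ι → E d → ℝ≥0∞} (hg : ∀ i, i ∉ Set.range e → ∀ x, g i x = 0) :
    lpLqNorm p q g = lpLqNorm p q (fun j => g (e j)) := by
  unfold lpLqNorm
  congr 2 with x
  rw [lqNorm_comp_of_injective hq he fun i hi => hg i hi x]

/-- Monotone convergence in `N`. It lets finite sums of pieces suffice, so no infinite modulated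
series has to converge. -/
theorem lpLqNorm_le_of_truncation_le (hp : 0 < p) (hq : 0 < q) {g : ℕ → E d → ℝ≥0∞}
    (hg : ∀ j, Measurable (g j)) {B : ℝ≥0∞}
    (h : ∀ N : ℕ, lpLqNorm p q (fun j x => if j < N then g j x else 0) ≤ B) :
    lpLqNorm p q g ≤ B := by
  unfold lpLqNorm at h ⊢
  rw [one_div, ENNReal.rpow_inv_le_iff hp]
  simp_rw [one_div, ENNReal.rpow_inv_le_iff hp] at h
  have hsup : ∀ x, lqNorm q (fun j => g j x) ^ p =
      ⨆ N : ℕ, lqNorm q (fun j => if j < N then g j x else 0) ^ p := fun x => by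
    rw [lqNorm_eq_iSup_truncation hq]
    exact (ENNReal.orderIsoRpow p hp).map_iSup _
  simp_rw [hsup]
  rw [MeasureTheory.lintegral_iSup]
  · exact iSup_le h
  · intro N
    refine (measurable_lqNorm fun j => ?_).pow_const p
    by_cases hj : j < N <;> simp [hj, hg j]
  · intro N M hNM x
    refine ENNReal.rpow_le_rpow (lqNorm_mono fun j => ?_) hp.le
    split_ifs <;> first | exact le_rfl | exact zero_le | omega

end SequenceNorms

/-! ### Supports and plateaus of dyadic systems. -/

section Dyadic

variable {V : Type*} [NormedAddCommGroup V] [NormedSpace ℝ V] {φ : V → ℂ}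

theorem norm_le_of_dyadic_ne_zero (h0 : ∀ x, 3 / 2 < ‖x‖ → φ x = 0) {j : ℕ} {x : V}
    (hx : dyadic φ j x ≠ 0) : ‖x‖ ≤ 3 / 2 * 2 ^ j := by
  by_contra! hlt
  apply hx
  have key : ∀ i : ℕ, i ≤ j → φ (((2 : ℝ) ^ i)⁻¹ • x) = 0 := fun i hi => by
    apply h0
    rw [norm_smul, norm_inv, norm_pow, Real.norm_ofNat, inv_mul_eq_div,
      lt_div_iff₀ (by positivity)]
    exact lt_of_le_of_lt (by gcongr; norm_num) hlt
  cases j with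
  | zero => simpa [dyadic] using key 0 le_rfl
  | succ j => simp only [dyadic]; rw [key _ le_rfl, key _ (Nat.le_succ j), sub_zero]

/-- On the inner part of the `k`-th dyadic annulus the dyadic system reduces to its `k`-th
member. -/
theorem dyadic_eq_ite (h1 : ∀ x, ‖x‖ ≤ 1 → φ x = 1) (h0 : ∀ x, 3 / 2 < ‖x‖ → φ x = 0)
    {k : ℕ} (hk : 0 < k) {x : V} (hx1 : 3 / 4 * 2 ^ k < ‖x‖) (hx2 : ‖x‖ ≤ 2 ^ k) (m : ℕ) :
    dyadic φ m x = if m = k then 1 else 0 := by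
  have big : ∀ i : ℕ, k ≤ i → φ (((2 : ℝ) ^ i)⁻¹ • x) = 1 := fun i hi => by
    apply h1
    rw [norm_smul, norm_inv, norm_pow, Real.norm_ofNat, inv_mul_eq_div,
      div_le_one (by positivity)]
    exact hx2.trans (by gcongr; norm_num)
  -- The lower bound `3/4 * 2^k` is `3/2 * 2^(k-1)`, exactly where the next finer dilate has
  -- vanished.
  have small : ∀ i : ℕ, i < k → φ (((2 : ℝ) ^ i)⁻¹ • x) = 0 := fun i hi => by
    apply h0
    rw [norm_smul, norm_inv, norm_pow, Real.norm_ofNat, inv_mul_eq_div,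
      lt_div_iff₀ (by positivity)]
    refine lt_of_le_of_lt ?_ hx1
    have : (2 : ℝ) ^ (i + 1) ≤ 2 ^ k := pow_le_pow_right₀ one_le_two hi
    rw [pow_succ] at this
    linarith
  cases m with
  | zero => simpa [dyadic, hk.ne] using small 0 hk
  | succ m =>
    simp only [dyadic]
    rcases lt_trichotomy (m + 1) k with hm | hm | hm
    · rw [small _ hm, small _ (by omega), if_neg hm.ne, sub_zero]
    · rw [big _ hm.ge, small _ (by omega), if_pos hm, sub_zero]
    · rw [big _ hm.le, big _ (by omega), if_neg hm.ne', sub_self]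

theorem UnivariateGenerator.eq_zero (χ : UnivariateGenerator) (x : ℝ) (hx : 3 / 2 < ‖x‖) :
    χ.toFun x = 0 := by
  refine image_eq_zero_of_notMem_tsupport fun h => ?_
  have := χ.tsupport_subset h
  rw [Set.mem_Icc, ← abs_le, ← Real.norm_eq_abs] at this
  linarith

end Dyadic

/-! ### Pieces of modulated sums. -/

section Transference

variable {d : ℕ}

/-- The Schwartz function `m(2π ·)` for a smooth compactly supported `m`. -/
def symbol (m : E d → ℂ) (hm : ContDiff ℝ ∞ m) (hs : HasCompactSupport m) : 𝓢(E d, ℂ) :=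
  HasCompactSupport.toSchwartzMap (hs.comp_smul (c := 2 * Real.pi) (by positivity))
    (hm.comp (contDiff_const_smul (2 * Real.pi)))

theorem symbol_apply (m : E d → ℂ) (hm : ContDiff ℝ ∞ m) (hs : HasCompactSupport m) (η : E d) :
    symbol m hm hs η = m ((2 * Real.pi) • η) := rfl

theorem piece_eq (m : E d → ℂ) (hm : ContDiff ℝ ∞ m) (hs : HasCompactSupport m)
    (f : 𝓢'(E d, ℂ)) (x : E d) :
    piece m hm hs f x = f (SchwartzMap.compSubConstCLM ℂ x (𝓕 (symbol m hm hs))) := rfl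

/-- Supplies the measurability required by monotone convergence. -/
theorem continuous_piece (m : E d → ℂ) (hm : ContDiff ℝ ∞ m) (hs : HasCompactSupport m)
    (f : 𝓢'(E d, ℂ)) : Continuous (piece m hm hs f) :=
  f.continuous.comp (continuous_compSubConstCLM _)

theorem piece_modulate (m a : E d → ℂ) (hm : ContDiff ℝ ∞ m) (hs : HasCompactSupport m)
    (ha : ContDiff ℝ ∞ a) (has : HasCompactSupport a) (ξ : E d) (c : ℂ)
    (h : ∀ η, a η * m (η + ξ) = c * a η) (f : 𝓢'(E d, ℂ)) (x : E d) :
    piece m hm hs (modulate (symbol a ha has) ((2 * Real.pi)⁻¹ • ξ) f) x =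
      c * (Real.fourierChar (inner ℝ x ((2 * Real.pi)⁻¹ • ξ)) : ℂ) * piece a ha has f x := by
  rw [piece_eq, piece_eq]
  refine modulate_apply_compSubConstCLM_fourier _ _ _ _ _ (fun η => ?_) _
  -- The factor `(2π)⁻¹` in the modulation cancels the dilation by `2π` in `symbol`, leaving a shift
  -- by `ξ`.
  rw [symbol_apply, symbol_apply, smul_add, smul_inv_smul₀ (by positivity)]
  exact h _

variable {a : ℕ → E d → ℂ} (ha : ∀ j, ContDiff ℝ ∞ (a j)) (has : ∀ j, HasCompactSupport (a j))

/-- The first `N` pieces of `f` with respect to the multipliers `a j`, modulated with the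
frequencies `ξ j` and summed up. -/
def modulatedSum (ξ : ℕ → E d) (N : ℕ) (f : 𝓢'(E d, ℂ)) : 𝓢'(E d, ℂ) :=
  ∑ j ∈ Finset.range N, modulate (symbol (a j) (ha j) (has j)) ((2 * Real.pi)⁻¹ • ξ j) f

variable {ι : Type*} {m : ι → E d → ℂ} (hm : ∀ i, ContDiff ℝ ∞ (m i))
  (hms : ∀ i, HasCompactSupport (m i)) {e : ℕ → ι} {ξ : ℕ → E d}

theorem piece_modulatedSum [DecidableEq ι]
    (h : ∀ j i η, a j η ≠ 0 → m i (η + ξ j) = if i = e j then 1 else 0) (N : ℕ)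
    (f : 𝓢'(E d, ℂ)) (i : ι) (x : E d) :
    piece (m i) (hm i) (hms i) (modulatedSum ha has ξ N f) x =
      ∑ j ∈ Finset.range N, (if i = e j then 1 else 0) *
        (Real.fourierChar (inner ℝ x ((2 * Real.pi)⁻¹ • ξ j)) : ℂ) *
          piece (a j) (ha j) (has j) f x := by
  have hsum : piece (m i) (hm i) (hms i) (modulatedSum ha has ξ N f) x =
      ∑ j ∈ Finset.range N, piece (m i) (hm i) (hms i)
        (modulate (symbol (a j) (ha j) (has j)) ((2 * Real.pi)⁻¹ • ξ j) f) x := by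
    simp only [piece_eq, modulatedSum]
    exact sum_apply _ _ _
  rw [hsum]
  refine Finset.sum_congr rfl fun j _ => piece_modulate _ _ _ _ _ _ _ _ (fun η => ?_) _ _
  by_cases hη : a j η = 0
  · simp [hη]
  · rw [h j i η hη, mul_comm]

/-- If the system `m` singles out the index `e j` on the support of `a j` shifted by `ξ j`, then
the `L_p(ℓ_q)` quasi-norm of the `m`-pieces of the modulated sum is that of the truncated sequence
of `a`-pieces. -/
theorem lpLqNorm_piece_modulatedSum [DecidableEq ι] (he : Function.Injective e)
    (h : ∀ j i η, a j η ≠ 0 → m i (η + ξ j) = if i = e j then 1 else 0)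
    {p : ℝ} {q : ℝ≥0∞} (hq : 0 < q) (w : ι → ℝ≥0∞) (N : ℕ) (f : 𝓢'(E d, ℂ)) :
    lpLqNorm p q (fun i x =>
        w i * ‖piece (m i) (hm i) (hms i) (modulatedSum ha has ξ N f) x‖ₑ) =
      lpLqNorm p q (fun j x =>
        if j < N then w (e j) * ‖piece (a j) (ha j) (has j) f x‖ₑ else 0) := by
  have h' := piece_modulatedSum ha has hm hms h N f
  rw [lpLqNorm_comp_of_injective hq he]
  · congr 1 with j x
    simp_rw [h', he.eq_iff, ite_mul, one_mul, zero_mul, Finset.sum_ite_eq, Finset.mem_range]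
    split_ifs
    -- One summand survives, and its character has modulus one.
    · rw [enorm_mul, ← ofReal_norm (_ : ℂ), Circle.norm_coe, ENNReal.ofReal_one, one_mul]
    · simp
  · intro i hi x
    rw [h', Finset.sum_eq_zero, enorm_zero, mul_zero]
    intro j _
    rw [if_neg fun hij => hi ⟨j, hij.symm⟩]
    simp

end Transference

/-! ### Frequency shifts into common plateaus. -/

section Frequencies

variable {d : ℕ}

/-- The exponents of a dyadic rectangle with one dominating side, in the direction `i₀`. -/
def sideExponent (i₀ i : Fin d) : ℕ := if i = i₀ then d + 7 else 4

/-- The centre of the inner part of the dyadic rectangle with exponents `j + sideExponent i₀ i`. -/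
def frequency (i₀ : Fin d) (j : ℕ) : E d :=
  (2 : ℝ) ^ j • WithLp.toLp 2 fun i => 7 / 8 * (2 : ℝ) ^ sideExponent i₀ i

theorem frequency_apply (i₀ : Fin d) (j : ℕ) (i : Fin d) :
    frequency i₀ j i = 7 / 8 * (2 : ℝ) ^ (j + sideExponent i₀ i) := by
  simp only [frequency, PiLp.smul_apply, smul_eq_mul, pow_add]
  ring

theorem coord_add_frequency_bounds (i₀ : Fin d) (j : ℕ) {η : E d} (hη : ‖η‖ ≤ 3 / 2 * 2 ^ j)
    (i : Fin d) : 3 / 4 * 2 ^ (j + sideExponent i₀ i) < (η + frequency i₀ j) i ∧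
      (η + frequency i₀ j) i ≤ 2 ^ (j + sideExponent i₀ i) := by
  have h1 := abs_le.1 ((PiLp.norm_apply_le η i).trans hη)
  have h2 : (16 : ℝ) ≤ 2 ^ sideExponent i₀ i := by
    calc (16 : ℝ) = 2 ^ 4 := by norm_num
      _ ≤ _ := pow_le_pow_right₀ one_le_two (by unfold sideExponent; split_ifs <;> omega)
  have h3 : (0 : ℝ) < 2 ^ j := by positivity
  rw [PiLp.add_apply, frequency_apply, pow_add]
  -- The centre `7/8` leaves a margin of `1/8` of the side, at least `2 * 2^j`, more than the radius
  -- `3/2 * 2^j`.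
  constructor <;> nlinarith [mul_le_mul_of_nonneg_left h2 h3.le]

/-- After scaling, the dominating coordinate is `112 * 2^d` and the others are `14`, so the
Euclidean norm barely exceeds the former and stays `3/2` below `128 * 2^d`. The `d` in `d + 7` makes
this work in every dimension. -/
theorem norm_frequency_le (i₀ : Fin d) (j : ℕ) :
    ‖frequency i₀ j‖ ≤ 2 ^ j * (2 ^ (d + 7) - 3 / 2) := by
  have hP : (d : ℝ) + 1 ≤ 2 ^ d := by exact_mod_cast Nat.lt_two_pow_self
  have hd : (0 : ℝ) ≤ d := d.cast_nonneg
  rw [frequency, norm_smul, norm_pow, Real.norm_ofNat]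
  gcongr
  have h7 : (2 : ℝ) ^ (d + 7) = 128 * 2 ^ d := by rw [pow_add]; ring
  refine abs_le_of_sq_le_sq' ?_ (by rw [h7]; linarith) |>.2
  rw [EuclideanSpace.real_norm_sq_eq]
  -- Here `196 = 14 ^ 2`; adding it also at `i₀` is harmless and makes the sum uniform.
  have hle : ∀ i : Fin d, (7 / 8 * (2 : ℝ) ^ sideExponent i₀ i) ^ 2 ≤
      (if i = i₀ then (112 * (2 : ℝ) ^ d) ^ 2 else 0) + 196 := fun i => by
    unfold sideExponent
    split_ifs
    · rw [h7]; nlinarith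
    · norm_num
  refine (Finset.sum_le_sum fun i _ => hle i).trans ?_
  rw [Finset.sum_add_distrib, Finset.sum_ite_eq' Finset.univ i₀]
  simp only [Finset.mem_univ, if_true, Finset.sum_const, Finset.card_univ, Fintype.card_fin,
    nsmul_eq_mul]
  rw [h7]
  nlinarith

theorem norm_add_frequency_bounds (i₀ : Fin d) (j : ℕ) {η : E d} (hη : ‖η‖ ≤ 3 / 2 * 2 ^ j) :
    3 / 4 * 2 ^ (j + (d + 7)) < ‖η + frequency i₀ j‖ ∧
      ‖η + frequency i₀ j‖ ≤ 2 ^ (j + (d + 7)) := by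
  constructor
  · have h := (coord_add_frequency_bounds i₀ j hη i₀).1
    rw [sideExponent, if_pos rfl] at h
    exact h.trans_le ((le_abs_self _).trans (PiLp.norm_apply_le (η + frequency i₀ j) i₀))
  · refine (norm_add_le _ _).trans ?_
    rw [pow_add]
    linarith [norm_frequency_le i₀ j]

theorem dyadic_add_frequency (φ : IsotropicGenerator d) (i₀ : Fin d) (j m : ℕ) (η : E d)
    (hη : dyadic (fun x => (φ.toFun x : ℂ)) j η ≠ 0) :
    dyadic (fun x => (φ.toFun x : ℂ)) m (η + frequency i₀ j) =
      if m = j + (d + 7) then 1 else 0 := by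
  have h0 : ∀ x, 3 / 2 < ‖x‖ → (φ.toFun x : ℂ) = 0 := fun x hx => by simp [φ.eq_zero x hx.le]
  have hb := norm_add_frequency_bounds i₀ j (norm_le_of_dyadic_ne_zero h0 hη)
  exact dyadic_eq_ite (fun x hx => by simp [φ.eq_one x hx]) h0 (by omega) hb.1 hb.2 m

theorem tensor_add_frequency (φ : IsotropicGenerator d) (χ : UnivariateGenerator) (i₀ : Fin d)
    (j : ℕ) (k : Fin d → ℕ) (η : E d)
    (hη : dyadic (fun x => (φ.toFun x : ℂ)) j η ≠ 0) :
    tensor χ.toFun k (η + frequency i₀ j) =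
      if k = fun i => j + sideExponent i₀ i then 1 else 0 := by
  have h0 : ∀ x, 3 / 2 < ‖x‖ → (φ.toFun x : ℂ) = 0 := fun x hx => by simp [φ.eq_zero x hx.le]
  have hfac : ∀ i, dyadic χ.toFun (k i) ((η + frequency i₀ j) i) =
      if k i = j + sideExponent i₀ i then 1 else 0 := fun i => by
    have hb := coord_add_frequency_bounds i₀ j (norm_le_of_dyadic_ne_zero h0 hη) i
    have hpos : 0 < (η + frequency i₀ j) i := lt_trans (by positivity) hb.1
    refine dyadic_eq_ite χ.eq_one χ.eq_zero (by unfold sideExponent; split_ifs <;> omega) ?_ ?_ _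
    · rw [Real.norm_of_nonneg hpos.le]; exact hb.1
    · rw [Real.norm_of_nonneg hpos.le]; exact hb.2
  simp only [tensor, hfac, Finset.prod_ite_zero, Finset.prod_const_one, Finset.mem_univ,
    true_imp_iff, funext_iff]

end Frequencies

/-! ### Quasi-norms of the shifted sums. -/

section Norms

variable {d : ℕ} (φ : IsotropicGenerator d) (χ : UnivariateGenerator) {p : ℝ} {q : ℝ≥0∞}

/-- The sum of the first `N` isotropic pieces of `f`, the `j`-th one being shifted in frequency
by `frequency i₀ j`. -/
def shiftedSum (i₀ : Fin d) (N : ℕ) (f : 𝓢'(E d, ℂ)) : 𝓢'(E d, ℂ) :=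
  modulatedSum (a := dyadic fun x => (φ.toFun x : ℂ)) (contDiff_dyadic φ.contDiff_ofReal)
    (hasCompactSupport_dyadic φ.hasCompactSupport) (frequency i₀) N f

/-- The quasi-norm of the first `N` pieces of `f` in `F^t_{p,q}`. -/
def truncatedNormF (t p : ℝ) (q : ℝ≥0∞) (N : ℕ) (f : 𝓢'(E d, ℂ)) : ℝ≥0∞ :=
  lpLqNorm p q fun (j : ℕ) x =>
    if j < N then ENNReal.ofReal ((2 : ℝ) ^ ((j : ℝ) * t)) *
      ‖piece (dyadic (fun x => (φ.toFun x : ℂ)) j) (contDiff_dyadic φ.contDiff_ofReal j)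
        (hasCompactSupport_dyadic φ.hasCompactSupport j) f x‖ₑ else 0

theorem truncatedNormF_le_normF (hp : 0 < p) (t : ℝ) (N : ℕ) (f : 𝓢'(E d, ℂ)) :
    truncatedNormF φ t p q N f ≤ normF φ t p q f :=
  lpLqNorm_mono hp fun j x => by split_ifs <;> simp

theorem normF_le_of_truncatedNormF_le (hp : 0 < p) (hq : 0 < q) {t : ℝ} {f : 𝓢'(E d, ℂ)}
    {B : ℝ≥0∞} (h : ∀ N, truncatedNormF φ t p q N f ≤ B) : normF φ t p q f ≤ B :=
  lpLqNorm_le_of_truncation_le hp hq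
    (fun _ => (continuous_piece _ _ _ f).enorm.measurable.const_mul _) h

theorem normF_shiftedSum (hp : 0 < p) (hq : 0 < q) (t : ℝ) (i₀ : Fin d) (N : ℕ)
    (f : 𝓢'(E d, ℂ)) :
    normF φ t p q (shiftedSum φ i₀ N f) =
      ENNReal.ofReal (2 ^ (((d + 7 : ℕ) : ℝ) * t)) * truncatedNormF φ t p q N f := by
  unfold normF shiftedSum
  rw [lpLqNorm_piece_modulatedSum _ _ _ _ (e := fun j => j + (d + 7)) (add_left_injective _)
    (fun j i η hη => dyadic_add_frequency φ i₀ j i η hη) hq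
    (fun j : ℕ => ENNReal.ofReal ((2 : ℝ) ^ ((j : ℝ) * t))), truncatedNormF,
    ← lpLqNorm_const_mul hp hq ENNReal.ofReal_ne_top]
  congr 1 with j x
  rw [mul_ite, mul_zero, ← mul_assoc, ← ENNReal.ofReal_mul (by positivity),
    ← Real.rpow_add two_pos, ← add_mul, ← Nat.cast_add, add_comm j]

theorem normSF_shiftedSum (hp : 0 < p) (hq : 0 < q) (t : ℝ) (i₀ : Fin d) (N : ℕ)
    (f : 𝓢'(E d, ℂ)) :
    normSF χ t p q (shiftedSum φ i₀ N f) =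
      ENNReal.ofReal (2 ^ (((∑ i, sideExponent i₀ i : ℕ) : ℝ) * t)) *
        truncatedNormF φ (t * d) p q N f := by
  unfold normSF shiftedSum
  rw [lpLqNorm_piece_modulatedSum _ _ _ _ (e := fun j i => j + sideExponent i₀ i)
    (fun j j' h => Nat.add_right_cancel (congrFun h i₀))
    (fun j k η hη => tensor_add_frequency φ χ i₀ j k η hη) hq
    (fun k : Fin d → ℕ => ENNReal.ofReal ((2 : ℝ) ^ (((∑ i, k i : ℕ) : ℝ) * t))),
    truncatedNormF, ← lpLqNorm_const_mul hp hq ENNReal.ofReal_ne_top]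
  congr 1 with j x
  rw [mul_ite, mul_zero, ← mul_assoc, ← ENNReal.ofReal_mul (by positivity),
    ← Real.rpow_add two_pos]
  -- The exponents sum to `d * j` plus a constant: this is the source of the smoothness `t * d`.
  congr 5
  simp only [Finset.sum_add_distrib, Finset.sum_const, Finset.card_univ, Fintype.card_fin,
    smul_eq_mul]
  push_cast
  ring

end Norms

end LizorkinTriebel

end

/-! ### The embedding theorem. -/

theorem theorem3p12 (d : ℕ) (hd : 2 ≤ d)
    (φ : LizorkinTriebel.IsotropicGenerator d) (χ : LizorkinTriebel.UnivariateGenerator)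
    (p : ℝ) (hp : 0 < p) (q : ℝ≥0∞) (hq : 0 < q) (t : ℝ)
    (p₀ : ℝ) (hp₀ : 0 < p₀) (q₀ : ℝ≥0∞) (hq₀ : 0 < q₀) (t₀ : ℝ)
    (h : LizorkinTriebel.Embeds (LizorkinTriebel.normF φ t₀ p₀ q₀)
      (LizorkinTriebel.normSF χ t p q)) :
    LizorkinTriebel.Embeds (LizorkinTriebel.normF φ t₀ p₀ q₀)
      (LizorkinTriebel.normF φ (t * d) p q) := by
  obtain ⟨-, C, hC⟩ := h
  let i₀ : Fin d := ⟨0, by omega⟩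
  set A : ℝ≥0 := ((2 : ℝ) ^ (((d + 7 : ℕ) : ℝ) * t₀)).toNNReal
  set B : ℝ≥0 :=
    ((2 : ℝ) ^ (((∑ i, LizorkinTriebel.sideExponent i₀ i : ℕ) : ℝ) * t)).toNNReal
  have hB : B ≠ 0 := (Real.toNNReal_pos.2 (by positivity)).ne'
  have bound : ∀ f, LizorkinTriebel.normF φ t₀ p₀ q₀ f < ⊤ →
      LizorkinTriebel.normF φ (t * d) p q f ≤
        (B⁻¹ * C * A : ℝ≥0) * LizorkinTriebel.normF φ t₀ p₀ q₀ f := by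
    intro f hf
    refine LizorkinTriebel.normF_le_of_truncatedNormF_le φ hp hq fun N => ?_
    have hF := LizorkinTriebel.normF_shiftedSum φ hp₀ hq₀ t₀ i₀ N f
    have hle : LizorkinTriebel.normF φ t₀ p₀ q₀ (LizorkinTriebel.shiftedSum φ i₀ N f) ≤
        A * LizorkinTriebel.normF φ t₀ p₀ q₀ f := by
      rw [hF]
      exact mul_le_mul_right (LizorkinTriebel.truncatedNormF_le_normF φ hp₀ t₀ N f) _
    -- The embedding is tested on the shifted sum, which lies in the source space by `hle`.
    have hS := hC _ (hle.trans_lt (ENNReal.mul_lt_top ENNReal.coe_lt_top hf))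
    rw [LizorkinTriebel.normSF_shiftedSum φ χ hp hq] at hS
    have hS' := hS.trans (mul_le_mul_right hle (C : ℝ≥0∞))
    rw [ENNReal.coe_mul, ENNReal.coe_mul, ENNReal.coe_inv hB, mul_assoc, mul_assoc,
      mul_comm (B : ℝ≥0∞)⁻¹, ← div_eq_mul_inv,
      ENNReal.le_div_iff_mul_le (by simp [hB]) (by simp), mul_comm]
    exact hS'
  exact ⟨fun f hf => (bound f hf).trans_lt (ENNReal.mul_lt_top ENNReal.coe_lt_top hf), _, bound⟩
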